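/- Let $R$ be a commutative unitary ring. A set $X\subseteq R^n$ is called Diophantine over $R$ if there are $m,r\ge 0$ and polynomials $F_1,\dots,F_r\in R[x_1,\dots,x_n,y_1,\dots,y_m]$ such that $$X=\{x\in R^n : \text{there is } y\in R^m \text{ with } F_1(x,y)=\cdots=F_r(x,y)=0\}.$$ The set $\mathbb{C}\setminus\mathbb{Z}$, regarded as a set of constant polynomials in $\mathbb{C}[z]$, is not Diophantine over $\mathbb{C}[z]$. The set $\mathbb{R}\setminus\mathbb{Q}$, regarded as a set of constant polynomials in $\mathbb{R}[z]$, is not Diophantine over $\mathbb{R}[z]$. -/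

import Mathlib

/-- A set `X ⊆ Rⁿ` is Diophantine over the commutative ring `R` if there are finitely many
polynomials `F₁, …, F_r ∈ R[x₁, …, xₙ, y₁, …, y_m]` such that `x ∈ X` if and only if the system
`F₁(x, y) = ⋯ = F_r(x, y) = 0` has a solution `y ∈ Rᵐ`. The variables `x` are indexed by the left
summand of `Fin n ⊕ Fin m`, the variables `y` by the right one. -/
def IsDiophantine {R : Type*} [CommRing R] {n : ℕ} (X : Set (Fin n → R)) : Prop :=
  ∃ (m r : ℕ) (F : Fin r → MvPolynomial (Fin n ⊕ Fin m) R),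
    ∀ x : Fin n → R, x ∈ X ↔
      ∃ y : Fin m → R, ∀ i : Fin r, MvPolynomial.eval (Sum.elim x y) (F i) = 0

/-- A subset of `R` is Diophantine over `R` if it is so as a subset of `R¹`. -/
def IsDiophantineSubset {R : Type*} [CommRing R] (S : Set R) : Prop :=
  IsDiophantine {x : Fin 1 → R | x 0 ∈ S}

/-- The set of constant polynomials in `A[z]` whose value lies in `S ⊆ A`. -/
def constantsIn {A : Type*} [CommRing A] (S : Set A) : Set (Polynomial A) :=
  Polynomial.C '' S

/-!
The two sets are excluded by a common specialization principle. Let `K` be an uncountable field of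
characteristic zero and let `S ⊆ K`, as a set of constants, be Diophantine over `K[z]`. The finitely
many coefficients of the defining polynomials lie in a countable field `k`, so an uncountable `S`
contains an element `t` transcendental over `k`, and `t` comes with a solution `y` in `K[z]` of the
defining system. The point is that `t` can be moved and `y` follows it: for a suitable filter `l`
on `K`, the system has a solution for all parameters `s` near `t` in the sense of `l`, so that `S`
belongs to `l`.

To see this, `k` is first enlarged to a ring over which `t` is still transcendental, while `K`
becomes algebraic over the ring generated by `t` (`exists_transcendental_isAlgebraic`). The
coefficients of `y` then generate a finite separable extension `E = k(t)(θ)` of the rational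
function field `k(t)`. Functions `K → K` taken modulo `l` form the ring `Germ l K`, and `k(t)` maps
to it by sending `t` to the germ of the identity, as nonzero polynomials have finitely many zeros.
This homomorphism extends to `E` as soon as the minimal polynomial of `θ` has a root in the ring
of germs (`exists_ringHom_germ`), that is, if the simple root `θ` at the parameter `t` leads to
some root at all parameters `s` close to `t`; this is the property `SimpleRootsPersist l t`.
Transporting `y` along `E → Germ l K` gives the solutions (`eventually_exists_evalAlong_eq_zero`).

Over an algebraically closed field the property holds for the filter of cofinite sets
(`simpleRootsPersist_cofinite`), so `S` is cofinite, and `ℂ ∖ ℤ` is not. Over `ℝ` it holds for the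
neighbourhoods of `t` by the intermediate value theorem (`simpleRootsPersist_nhds`), so `S`
has interior points, and `ℝ ∖ ℚ` has none.
-/

section

open Polynomial Filter Topology

/-! ### Persistence of simple roots -/

/-- A simple root `θ` of a polynomial `p(t, Y)`, where `p ∈ K[X][Y]`, implies that `p(s, Y)` has
some root for all `s` in a set of the filter `l`. Nothing is asked about how that root depends
on `s`. -/
def SimpleRootsPersist {K : Type*} [Field K] (l : Filter K) (t : K) : Prop :=
  ∀ (p : K[X][X]) (θ : K), p.evalEval t θ = 0 → (derivative p).evalEval t θ ≠ 0 →
    ∀ᶠ s in l, ∃ θ' : K, p.evalEval s θ' = 0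

theorem SimpleRootsPersist.mono {K : Type*} [Field K] {l l' : Filter K} {t : K}
    (h : SimpleRootsPersist l t) (hl : l' ≤ l) : SimpleRootsPersist l' t :=
  fun p θ h0 h1 ↦ (h p θ h0 h1).filter_mono hl

theorem eventually_cofinite_eval_ne_zero {K : Type*} [Field K] {p : K[X]} (hp : p ≠ 0) :
    ∀ᶠ s in cofinite, p.eval s ≠ 0 := by
  rw [eventually_cofinite]
  simpa using p.finite_setOfPred_isRoot hp

theorem simpleRootsPersist_cofinite {K : Type*} [Field K] [IsAlgClosed K] (t : K) :
    SimpleRootsPersist cofinite t := by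
  intro p θ _ hθ
  -- The derivative does not vanish, so `p` is not constant in `Y`; its degree in `Y` drops at
  -- only finitely many parameters.
  have hn : p.natDegree ≠ 0 := by
    intro h
    rw [eq_C_of_natDegree_eq_zero h] at hθ
    simp at hθ
  have hp : p.leadingCoeff ≠ 0 := by
    rintro h
    simp [leadingCoeff_eq_zero.mp h] at hn
  filter_upwards [eventually_cofinite_eval_ne_zero hp] with s hs
  have hdeg : (p.map (evalRingHom s)).degree ≠ 0 := by
    rw [degree_map_eq_of_leadingCoeff_ne_zero _ (by simpa using hs)]
    exact fun h ↦ hn (natDegree_eq_of_degree_eq_some h)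
  obtain ⟨θ', h⟩ := IsAlgClosed.exists_root _ hdeg
  exact ⟨θ', by rwa [IsRoot, map_evalRingHom_eval] at h⟩

/-- A real function changes sign at a simple zero. -/
theorem HasDerivAt.exists_mul_neg {f : ℝ → ℝ} {d x : ℝ} (hd : HasDerivAt f d x) (hd0 : d ≠ 0)
    (h0 : f x = 0) : ∃ a b, f a * f b < 0 := by
  have hs : ∀ᶠ y in 𝓝[≠] x, 0 < d * slope f x y :=
    ((hasDerivAt_iff_tendsto_slope.mp hd).const_mul d).eventually_const_lt (mul_self_pos.mpr hd0)
  obtain ⟨a, ha, hax⟩ := ((hs.filter_mono (nhdsLT_le_nhdsNE x)).and self_mem_nhdsWithin).exists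
  obtain ⟨b, hb, hbx⟩ := ((hs.filter_mono (nhdsGT_le_nhdsNE x)).and self_mem_nhdsWithin).exists
  have hf : ∀ y, f y = (y - x) * slope f x y := fun y ↦ by
    simpa [h0] using (sub_smul_slope f x y).symm
  refine ⟨a, b, ?_⟩
  have h1 : 0 < slope f x a * slope f x b := by
    have := mul_pos ha hb
    rw [mul_mul_mul_comm] at this
    exact (mul_pos_iff_of_pos_left (mul_self_pos.mpr hd0)).mp this
  have h2 : (a - x) * (b - x) < 0 :=
    mul_neg_of_neg_of_pos (sub_neg.mpr hax) (sub_pos.mpr hbx)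
  rw [hf a, hf b, mul_mul_mul_comm]
  exact mul_neg_of_neg_of_pos h2 h1

theorem simpleRootsPersist_nhds (t : ℝ) : SimpleRootsPersist (𝓝 t) t := by
  intro p θ h0 hθ
  let f : ℝ → ℝ → ℝ := fun s y ↦ (p.map (evalRingHom s)).eval y
  have hf : ∀ s y, f s y = p.evalEval s y := fun s y ↦ map_evalRingHom_eval s y p
  have hfs : ∀ y, Continuous fun s ↦ f s y := fun y ↦ by
    simp only [hf, evalEval]
    fun_prop
  have hd : HasDerivAt (f t) ((derivative p).evalEval t θ) θ := by
    have := (p.map (evalRingHom t)).hasDerivAt θ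
    rwa [derivative_map, map_evalRingHom_eval] at this
  -- `f t` changes sign at its simple root, and the signs at the two fixed points `a` and `b`
  -- are kept when `t` moves a little.
  obtain ⟨a, b, hab⟩ := hd.exists_mul_neg hθ ((hf t θ).trans h0)
  have : ∀ᶠ s in 𝓝 t, f s a * f s b < 0 :=
    (((hfs a).mul (hfs b)).tendsto t).eventually_lt_const hab
  filter_upwards [this] with s hs
  have hc : Continuous (f s) := (p.map (evalRingHom s)).continuous
  obtain ⟨y, hy⟩ : ∃ y, f s y = 0 := by
    rcases mul_neg_iff.mp hs with ⟨h1, h2⟩ | ⟨h1, h2⟩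
    · exact mem_range_of_exists_le_of_exists_ge hc ⟨b, h2.le⟩ ⟨a, h1.le⟩
    · exact mem_range_of_exists_le_of_exists_ge hc ⟨a, h1.le⟩ ⟨b, h2.le⟩
  exact ⟨y, by rw [← hf, hy]⟩

/-! ### Extending the identity germ to algebraic elements -/

/-- The ring `A` is generated by a transcendence basis containing `t`, with `t` left out. -/
theorem exists_transcendental_isAlgebraic {k K : Type*} [Field k] [Field K] [Algebra k K] {t : K}
    (ht : Transcendental k t) :
    ∃ A : Subalgebra k K, Transcendental A t ∧ Algebra.IsAlgebraic (Algebra.adjoin A {t}) K := by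
  obtain ⟨B, htB, hB⟩ := exists_isTranscendenceBasis_superset (R := k) (s := {t})
    (algebraicIndependent_unique_type_iff.mpr ht)
  have htB : t ∈ B := htB rfl
  refine ⟨Algebra.adjoin k (B \ {t}), ?_, ?_⟩
  · have h := hB.1.transcendental_adjoin (i := ⟨t, htB⟩) (s := {⟨t, htB⟩}ᶜ) (by simp)
    have hs : ((↑) : B → K) '' {⟨t, htB⟩}ᶜ = B \ {t} := by
      ext x
      simp [and_comm]
    rwa [hs] at h
  · have h := hB.isAlgebraic
    rw [Subtype.range_coe, ← Set.sdiff_union_of_subset (Set.singleton_subset_iff.mpr htB),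
      Algebra.adjoin_union_eq_adjoin_adjoin] at h
    exact h

/-- A polynomial over `k` as a function on a `k`-algebra `K`. -/
noncomputable def polynomialFunction (k K : Type*) [CommRing k] [Field K] [Algebra k K] :
    k[X] →+* (K → K) :=
  RingHom.pi fun s ↦ (aeval s : k[X] →ₐ[k] K).toRingHom

/-- The germ along `l` of a polynomial function; it maps `X` to the germ of the identity. -/
noncomputable def polynomialGerm (k : Type*) {K : Type*} [CommRing k] [Field K] [Algebra k K]
    (l : Filter K) : k[X] →+* Germ l K :=
  (Germ.coeRingHom l).comp (polynomialFunction k K)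

theorem isUnit_polynomialGerm {k K : Type*} [CommRing k] [Field K] [Algebra k K] [FaithfulSMul k K]
    {l : Filter K} (hl : l ≤ cofinite) {p : k[X]} (hp : p ≠ 0) :
    IsUnit (polynomialGerm k l p) := by
  have hp' : p.map (algebraMap k K) ≠ 0 :=
    (Polynomial.map_ne_zero_iff (FaithfulSMul.algebraMap_injective k K)).mpr hp
  -- The pointwise inverse is junk only at the zeros of `p`, which `l` does not see.
  refine IsUnit.of_mul_eq_one (((fun s ↦ (aeval s p)⁻¹ : K → K) : Germ l K)) ?_
  refine Germ.coe_eq.mpr ?_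
  filter_upwards [hl (eventually_cofinite_eval_ne_zero hp')] with s hs
  rw [eval_map_algebraMap] at hs
  exact mul_inv_cancel₀ hs

theorem evalEval_map_mapRingHom_algebraMap {k K : Type*} [CommRing k] [Field K] [Algebra k K]
    (p : k[X][X]) (s y : K) :
    (p.map (mapRingHom (algebraMap k K))).evalEval s y =
      p.eval₂ (aeval s : k[X] →ₐ[k] K).toRingHom y := by
  rw [← map_evalRingHom_eval, Polynomial.map_map, eval_map]
  congr 1
  ext <;> simp

/-- If `K` is algebraic over `k[t]`, then every finite subset of `K` lies in a subring `E` that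
contains `k[t]` and has a homomorphism to germs sending `t` to the identity germ and elements of
`k` to constants. The inclusion of `k[t] ≅ k[X]` in `E` is given as `φ`. -/
theorem exists_ringHom_germ {k K : Type*} [CommRing k] [IsDomain k] [CharZero k] [Field K]
    [Algebra k K] [FaithfulSMul k K] {t : K} (ht : Transcendental k t)
    [Algebra.IsAlgebraic (Algebra.adjoin k {t}) K] {l : Filter K} (hl : l ≤ cofinite)
    (H : SimpleRootsPersist l t) {S : Set K} (hS : S.Finite) :
    ∃ (E : Subring K) (ψ : E →+* Germ l K) (φ : k[X] →+* E), S ⊆ E ∧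
      E.subtype.comp φ = (aeval t : k[X] →ₐ[k] K).toRingHom ∧ ψ.comp φ = polynomialGerm k l := by
  have := hS.to_subtype
  let f : k[X] →+* K := (aeval t : k[X] →ₐ[k] K).toRingHom
  have hf : Function.Injective f := transcendental_iff_injective.mp ht
  let : Algebra k[X] K := f.toAlgebra
  have : FaithfulSMul k[X] K := (faithfulSMul_iff_algebraMap_injective _ _).mpr hf
  let L := FractionRing k[X]
  let : Algebra L K := FractionRing.liftAlgebra k[X] K
  have : IsScalarTower k[X] L K := FractionRing.isScalarTower_liftAlgebra k[X] K
  have : CharZero L := charZero_of_injective_algebraMap (IsFractionRing.injective k[X] L)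
  have : Algebra.IsAlgebraic L K := by
    rw [← IsFractionRing.comap_isAlgebraic_iff (A := k[X])]
    refine Algebra.IsAlgebraic.of_ringHom_of_comp_eq (S := Algebra.adjoin k {t}) (B := K)
      (f.codRestrict (Algebra.adjoin k {t}) fun p ↦ aeval_mem_adjoin_singleton k t) (RingHom.id K)
      ?_ Function.injective_id rfl
    rintro ⟨y, hy⟩
    obtain ⟨p, rfl⟩ := Algebra.adjoin_singleton_eq_range_aeval k t ▸ hy
    exact ⟨p, rfl⟩
  let E := IntermediateField.adjoin L S
  have : FiniteDimensional L E := IntermediateField.finiteDimensional_adjoin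
    fun x _ ↦ Algebra.IsIntegral.isIntegral x
  let pb := Field.powerBasisOfFiniteOfSeparable L E
  let θ : K := pb.gen
  let g : L →+* Germ l K := IsLocalization.lift (M := nonZeroDivisors k[X])
    (g := polynomialGerm k l) fun q ↦ isUnit_polynomialGerm hl (nonZeroDivisors.ne_zero q.2)
  have hg : ∀ q : k[X], g (algebraMap k[X] L q) = polynomialGerm k l q := fun q ↦
    IsLocalization.lift_eq _ q
  let : Algebra L (Germ l K) := g.toAlgebra
  let P := minpoly L pb.gen
  have hPθ : aeval θ P = 0 := by
    have : aeval (algebraMap E K pb.gen) P = 0 := by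
      rw [aeval_algebraMap_apply, minpoly.aeval, map_zero]
    exact this
  have hsep : aeval θ (derivative P) ≠ 0 := by
    have : P.Separable := Algebra.IsSeparable.isSeparable L pb.gen
    exact this.aeval_derivative_ne_zero hPθ
  -- Persistence concerns polynomials in two variables, so denominators are cleared:
  -- `Q = b * P` has coefficients in `k[X]`.
  obtain ⟨b, hb, hQ⟩ := IsLocalization.integerNormalization_spec (nonZeroDivisors k[X]) P
  set Q := IsLocalization.integerNormalization (nonZeroDivisors k[X]) P
  have hb0 := nonZeroDivisors.ne_zero hb
  have hbK : algebraMap L K (algebraMap k[X] L b) ≠ 0 := by simpa [L] using hb0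
  rw [← algebraMap_smul L b P, smul_eq_C_mul] at hQ
  have hK : ∀ R : k[X][X], R.eval₂ f θ = aeval θ (R.map (algebraMap k[X] L)) := by
    intro R
    rw [aeval_map_algebraMap]
    rfl
  have hev : ∀ᶠ s in l, ∃ θ', (Q.map (mapRingHom (algebraMap k K))).evalEval s θ' = 0 := by
    refine H _ θ ?_ ?_
    · rw [evalEval_map_mapRingHom_algebraMap]
      refine (hK Q).trans ?_
      rw [hQ, map_mul, hPθ, mul_zero]
    · rw [derivative_map, evalEval_map_mapRingHom_algebraMap]
      refine ne_of_eq_of_ne (hK _) ?_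
      rw [← derivative_map, hQ, derivative_C_mul, map_mul, aeval_C]
      exact mul_ne_zero hbK hsep
  choose! r hr using fun s (h : ∃ θ', (Q.map (mapRingHom (algebraMap k K))).evalEval s θ' = 0) ↦ h
  have hroot : aeval (r : Germ l K) P = 0 := by
    have h0 : Q.eval₂ (polynomialGerm k l) (r : Germ l K) = 0 := by
      have h := hom_eval₂ Q (polynomialFunction k K) (Germ.coeRingHom l) r
      refine h.symm.trans (Germ.coe_eq.mpr ?_)
      filter_upwards [hev] with s hs
      refine (hom_eval₂ Q _ (Pi.evalRingHom (fun _ ↦ K) s) r).trans ?_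
      exact (evalEval_map_mapRingHom_algebraMap Q s (r s)).symm.trans (hr s hs)
    have h1 : aeval (r : Germ l K) (Q.map (algebraMap k[X] L)) = 0 := by
      rw [aeval_def, eval₂_map, ← h0]
      congr 1
      exact RingHom.ext hg
    rw [hQ, map_mul, aeval_C] at h1
    have hu : IsUnit (algebraMap L (Germ l K) (algebraMap k[X] L b)) :=
      (hg b).symm ▸ isUnit_polynomialGerm hl hb0
    exact hu.mul_right_eq_zero.mp h1
  let ψ : E →ₐ[L] Germ l K := pb.lift r hroot
  refine ⟨E.toSubring, ψ.toRingHom, (algebraMap L E).comp (algebraMap k[X] L),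
    IntermediateField.subset_adjoin L S, RingHom.ext fun p ↦ ?_, RingHom.ext fun p ↦ ?_⟩
  · exact (IsScalarTower.algebraMap_apply k[X] L K p).symm
  · exact (ψ.commutes _).trans (hg p)

/-! ### Moving the solution of a system -/

/-- The value in `R[z]` of a polynomial `F` over `k[z]` in two groups of variables. A homomorphism
`Φ : k[X] → R` records both the scalars `k → R` and the element `Φ X`; all variables of the first
group take the constant value `Φ X`, those of the second group the values `y`. -/
noncomputable def evalAlong {k R σ τ : Type*} [CommRing k] [CommRing R] (Φ : k[X] →+* R)
    (y : τ → R[X]) (F : MvPolynomial (σ ⊕ τ) k[X]) : R[X] :=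
  F.eval₂ (mapRingHom (Φ.comp C)) (Sum.elim (fun _ ↦ C (Φ X)) y)

theorem map_evalAlong {k R R' σ τ : Type*} [CommRing k] [CommRing R] [CommRing R'] (f : R →+* R')
    (Φ : k[X] →+* R) (y : τ → R[X]) (F : MvPolynomial (σ ⊕ τ) k[X]) :
    (evalAlong Φ y F).map f = evalAlong (f.comp Φ) (fun j ↦ (y j).map f) F := by
  have h := MvPolynomial.eval₂_comp_left (mapRingHom f) (mapRingHom (Φ.comp C))
    (Sum.elim (fun _ ↦ C (Φ X)) y) F
  refine h.trans ?_
  unfold evalAlong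
  congr 1
  · rw [mapRingHom_comp]
    rfl
  · ext1 (_ | _) <;> simp

/-- A solution of a system at the parameter `t` gives solutions for all parameters close to `t`
along `l`. -/
theorem eventually_exists_evalAlong_eq_zero {k K σ τ ι : Type*} [CommRing k] [IsDomain k]
    [CharZero k] [Field K] [Algebra k K] [FaithfulSMul k K] [Finite τ] [Finite ι] {t : K}
    (ht : Transcendental k t) [Algebra.IsAlgebraic (Algebra.adjoin k {t}) K] {l : Filter K}
    (hl : l ≤ cofinite) (H : SimpleRootsPersist l t) (F : ι → MvPolynomial (σ ⊕ τ) k[X])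
    (y : τ → K[X]) (hy : ∀ i, evalAlong (aeval t : k[X] →ₐ[k] K).toRingHom y (F i) = 0) :
    ∀ᶠ s in l, ∃ y' : τ → K[X],
      ∀ i, evalAlong (aeval s : k[X] →ₐ[k] K).toRingHom y' (F i) = 0 := by
  obtain ⟨E, ψ, φ, hE, hφ, hψ⟩ := exists_ringHom_germ ht hl H
    (Set.finite_iUnion fun j ↦ ((y j).coeffs.finite_toSet))
  have hlift : ∀ j, ∃ q : E[X], q.map E.subtype = y j := by
    intro j
    rw [← mem_lifts, lifts_iff_coeff_lifts]
    intro n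
    by_cases hn : (y j).coeff n = 0
    · exact ⟨0, by simp [hn]⟩
    · exact ⟨⟨_, hE (Set.mem_iUnion_of_mem j (coeff_mem_coeffs hn))⟩, rfl⟩
  choose yE hyE using hlift
  have hsolE : ∀ i, evalAlong φ yE (F i) = 0 := by
    intro i
    apply map_injective E.subtype E.subtype_injective
    rw [map_evalAlong, hφ, Polynomial.map_zero]
    simpa only [hyE] using hy i
  -- Representatives of the transported coefficients are chosen as functions of the parameter.
  have hrep : ∀ j, ∃ q : (K → K)[X], q.map (Germ.coeRingHom l) = (yE j).map ψ := fun j ↦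
    Polynomial.map_surjective (Germ.coeRingHom l) Quotient.mk_surjective ((yE j).map ψ)
  choose yF hyF using hrep
  have hsolF : ∀ i, (evalAlong (polynomialFunction k K) yF (F i)).map (Germ.coeRingHom l) = 0 := by
    intro i
    rw [map_evalAlong]
    simp only [hyF]
    change evalAlong (polynomialGerm k l) _ _ = 0
    rw [← hψ, ← map_evalAlong, hsolE, Polynomial.map_zero]
  have hcoeff : ∀ᶠ s in l, ∀ i,
      ∀ n ∈ (evalAlong (polynomialFunction k K) yF (F i)).support,
        (evalAlong (polynomialFunction k K) yF (F i)).coeff n s = 0 := by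
    rw [eventually_all]
    intro i
    rw [Filter.eventually_all_finset]
    intro n _
    have h := congrArg (fun q ↦ coeff q n) (hsolF i)
    rw [coeff_map, coeff_zero] at h
    exact Germ.coe_eq.mp h
  filter_upwards [hcoeff] with s hs
  refine ⟨fun j ↦ (yF j).map (Pi.evalRingHom (fun _ ↦ K) s), fun i ↦ ?_⟩
  refine (map_evalAlong (Pi.evalRingHom (fun _ ↦ K) s) (polynomialFunction k K) yF (F i)).symm.trans
    ?_
  ext n
  rw [coeff_map, coeff_zero]
  by_cases hn : n ∈ (evalAlong (polynomialFunction k K) yF (F i)).support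
  · exact hs i n hn
  · rw [notMem_support_iff.mp hn, map_zero]

/-! ### Diophantine sets of constants -/

theorem exists_transcendental_mem_of_finite {K : Type*} [Field K] {S T : Set K}
    (hS : ¬ S.Countable) (hT : T.Finite) :
    ∃ t ∈ S, Transcendental (Subfield.closure T) t := by
  have hk : Countable (Subfield.closure T) := by
    rw [← Cardinal.mk_le_aleph0_iff]
    exact (Subfield.cardinalMk_closure_le_max T).trans (max_le hT.countable.le_aleph0 le_rfl)
  by_contra! h
  exact hS ((Algebraic.countable (Subfield.closure T) K).mono fun t ht ↦ not_not.mp (h t ht))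

/-- An uncountable Diophantine set of constants contains an element `t` such that it belongs to
every filter finer than the cofinite one along which simple roots at `t` persist. -/
theorem IsDiophantineSubset.exists_eventually_mem {K : Type*} [Field K] [CharZero K] {S : Set K}
    (h : IsDiophantineSubset (constantsIn S)) (hS : ¬ S.Countable) :
    ∃ t ∈ S, ∀ l ≤ cofinite, SimpleRootsPersist l t → ∀ᶠ s in l, s ∈ S := by
  obtain ⟨m, r, F, hF⟩ := h
  let T : Set K := ⋃ i, ⋃ c ∈ (F i).coeffs, (c.coeffs : Set K)
  have hT : T.Finite := Set.finite_iUnion fun i ↦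
    (F i).coeffs.finite_toSet.biUnion fun c _ ↦ c.coeffs.finite_toSet
  obtain ⟨t, htS, ht⟩ := exists_transcendental_mem_of_finite hS hT
  refine ⟨t, htS, fun l hl H ↦ ?_⟩
  obtain ⟨A, htA, hA⟩ := exists_transcendental_isAlgebraic ht
  have : CharZero A := (algebraMap A K).charZero
  have hlift : ∀ i, ∃ G, MvPolynomial.map (mapRingHom (algebraMap A K)) G = F i := by
    intro i
    change F i ∈ Set.range _
    rw [MvPolynomial.mem_range_map_iff_coeffs_subset]
    intro c hc
    change c ∈ lifts _
    rw [lifts_iff_coeff_lifts]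
    intro n
    by_cases hn : c.coeff n = 0
    · exact ⟨0, by simp [hn]⟩
    · have hT : c.coeff n ∈ T :=
        Set.mem_iUnion_of_mem i (Set.mem_biUnion hc (coeff_mem_coeffs hn))
      exact ⟨algebraMap (Subfield.closure T) A ⟨_, Subfield.subset_closure hT⟩, rfl⟩
  choose G hG using hlift
  have heval : ∀ (s : K) (y : Fin m → K[X]) (i : Fin r),
      evalAlong (aeval s : A[X] →ₐ[A] K).toRingHom y (G i) =
        MvPolynomial.eval (Sum.elim (fun _ ↦ C s) y) (F i) := by
    intro s y i
    rw [← hG, MvPolynomial.eval_map]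
    unfold evalAlong
    congr 2
    · ext1
      simp
    · ext1
      simp
  have hmem : ∀ s : K, s ∈ S ↔ ∃ y : Fin m → K[X],
      ∀ i, evalAlong (aeval s : A[X] →ₐ[A] K).toRingHom y (G i) = 0 := by
    intro s
    simp only [heval]
    rw [← hF]
    exact (C_injective.mem_set_image).symm
  obtain ⟨y, hy⟩ := (hmem t).mp htS
  filter_upwards [eventually_exists_evalAlong_eq_zero htA hl H G y hy] with s hs
  exact (hmem s).mpr hs

theorem not_isDiophantineSubset_compl_range_int :
    ¬ IsDiophantineSubset (constantsIn ((Set.range ((↑) : ℤ → ℂ))ᶜ)) := by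
  intro h
  obtain ⟨t, -, ht⟩ := h.exists_eventually_mem fun hc ↦
    not_countable_complex <| by
      simpa using hc.union (Set.countable_range ((↑) : ℤ → ℂ))
  have hfin := eventually_cofinite.mp (ht cofinite le_rfl (simpleRootsPersist_cofinite t))
  exact Set.infinite_range_of_injective Int.cast_injective (by rwa [← compl_compl (Set.range _)])

theorem not_isDiophantineSubset_compl_range_rat :
    ¬ IsDiophantineSubset (constantsIn ((Set.range ((↑) : ℚ → ℝ))ᶜ)) := by
  intro h
  obtain ⟨t, -, ht⟩ := h.exists_eventually_mem fun hc ↦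
    Cardinal.not_countable_real <| by
      simpa using hc.union (Set.countable_range ((↑) : ℚ → ℝ))
  have hev := ht (𝓝[≠] t) (nhdsNE_le_cofinite t)
    ((simpleRootsPersist_nhds t).mono nhdsWithin_le_nhds)
  have hlt := hev.filter_mono (nhdsGT_le_nhdsNE t)
  obtain ⟨u, hu, hsub⟩ := mem_nhdsGT_iff_exists_Ioo_subset.mp hlt
  obtain ⟨q, hq⟩ := exists_rat_btwn (Set.mem_Ioi.mp hu)
  exact hsub hq ⟨q, rfl⟩

end

theorem mainTheorem6 :
    ¬ IsDiophantineSubset (constantsIn ((Set.range ((↑) : ℤ → ℂ))ᶜ)) ∧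
      ¬ IsDiophantineSubset (constantsIn ((Set.range ((↑) : ℚ → ℝ))ᶜ)) :=
  ⟨not_isDiophantineSubset_compl_range_int, not_isDiophantineSubset_compl_range_rat⟩
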